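/- Let $a \ge 2$ be an integer and let $c > 0$ be a real number. There is a constant $K > 0$, depending only on $a$ and $c$, with the following property. Let $m \ge a$ be an integer, let $X_1, \dots, X_m$ be independent real valued random variables, and for every $A \subseteq \{1, \dots, m\}$ with $|A| \le a$ let $f_A : \mathbb{R}^{|A|} \to \mathbb{R}$ be Borel measurable. Write $X_A = (X_i : i \in A)$ and $\mathrm{diam}\, A = \max A - \min A$ (with $\mathrm{diam}\, \emptyset = 0$). Suppose that for every $A \subseteq \{1,\dots,m\}$ with $|A| \le a$ we have $\mathrm{E}\, f_A(X_A) = 0$ and $|f_A(X_A)| \le e^{-c \cdot \mathrm{diam}\, A}$ almost surely, and that $$\sigma_m^2 = \mathrm{E} \Big( \sum_{A \subseteq \{1,\dots,m\},\ |A| \le a} f_A(X_A) \Big)^2 > 0, \qquad \sigma_m > 0 .$$ Then for every real number $\lambda$, $$\left| \Pr \Big( \frac{1}{\sigma_m} \sum_{A \subseteq \{1,\dots,m\},\ |A| \le a} f_A(X_A) < \lambda \Big) - \Phi(\lambda) \right| \le K \cdot (\log m)^{1/4} \cdot \frac{m^{3/4}}{\sigma_m^2},$$ where $\Phi(\lambda)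 = \int_{-\infty}^{\lambda} \frac{1}{\sqrt{2\pi}} e^{-x^2/2}\, dx$ is the standard normal distribution function. -/

import Mathlib

open MeasureTheory ProbabilityTheory

/-- The family of all subsets `A` of the `m`-element index set with `|A| ≤ a`. The index set
`{1, …, m}` is represented by `Fin m`, in its usual order. -/
def subsetsUpTo (m a : ℕ) : Finset (Finset (Fin m)) :=
  Finset.univ.filter fun A => A.card ≤ a

/-- The diameter `max A - min A` of a finite set of indices (`0` for the empty set). The natural
subtraction does not truncate, as `min A ≤ max A`. -/
def indexDiam {m : ℕ} (A : Finset (Fin m)) : ℕ :=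
  if h : A.Nonempty then (A.max' h : ℕ) - (A.min' h : ℕ) else 0

/-- The tuple `X_A = (X_i : i ∈ A)`, as a random vector. -/
def subfamily {Ω : Type*} {m : ℕ} (X : Fin m → Ω → ℝ) (A : Finset (Fin m)) (ω : Ω) : A → ℝ :=
  fun i => X i ω

/-- The random variable `∑ f_A(X_A)`, summed over all `A` with `|A| ≤ a`. -/
noncomputable def localSum {Ω : Type*} {m : ℕ} (a : ℕ) (X : Fin m → Ω → ℝ)
    (f : (A : Finset (Fin m)) → (A → ℝ) → ℝ) (ω : Ω) : ℝ :=
  ∑ A ∈ subsetsUpTo m a, f A (subfamily X A ω)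

/-- The standard normal distribution function `Φ`. -/
noncomputable def stdNormalCDF (x : ℝ) : ℝ := cdf (gaussianReal 0 1) x

/-!
# A Berry–Esseen type bound for sums of functions of few independent variables

The sum is a sum of locally dependent variables, and Stein's method applies. Write
`W = ∑ ξ_A` with `ξ_A = f_A(X_A) / σ`. Since `ξ_A` and `ξ_B` are functions of disjoint blocks of
independent variables when `A` and `B` are disjoint, `ξ_A` is independent of
`W_A = ∑ ξ_B`, the sum over all `B` disjoint from `A`. For a test function `h` with values in
`[0, 1]` and Lipschitz constant `L`, let `u` solve the Stein equation `u' x - x u x = h x - E h(N)`.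
Then `E W u(W) = ∑ E ξ_A (u(W) - u(W_A))`, and a first order expansion gives
`E h(W) - E h(N) = E u'(W) (1 - V) + R`, where `V` is the sum of `ξ_A ξ_B` over all pairs with
`A ∩ B ≠ ∅`. As `E V = E W ^ 2 = 1`, the first term is controlled by the standard deviation of `V`,
which is again a sum of locally dependent variables; the remainder `R` is controlled by the modulus
of continuity of `u'` (`abs_steinSolution_taylor_le`).

The only property of the weights `e^{-c diam A}` that enters is that the sets `A` with `|A| ≤ a`
through a given index have total weight at most a constant `S(a, c)`, whatever `m` is
(`sum_exp_indexDiam_le`); this is recorded in `LocalWeights`. Hence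
`|E h(W) - E h(N)| ≤ C (m (1 + L) / σ ^ 3 + m ^ (1 / 2) / σ ^ 2)`
(`LocalFamily.abs_integral_sub_gaussian_le`), with no truncation of the diameters, so that no
logarithm arises.

Ramps of width `δ = m ^ (3 / 4) / σ ^ 2`, with `L = 1 / δ`, turn this into a bound for the
distribution function (`abs_measureReal_lt_sub_stdNormalCDF_le`). The same count of meeting pairs
gives `σ ^ 2 ≤ C m` (`LocalFamily.integral_sum_sq_le`), and with it every error term is at most a
constant times `δ` when `δ < 1`; for `δ ≥ 1` the claim is trivial. The factor `(log m) ^ (1 / 4)` is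
bounded below because `m ≥ 2`.
-/

/-! ### The Stein equation for bounded continuous test functions -/

lemma integrable_exp_neg_sq_div_two : Integrable fun t : ℝ => Real.exp (-t ^ 2 / 2) := by
  have h := integrable_exp_neg_mul_sq (b := 1 / 2) (by norm_num)
  refine h.congr (.of_forall fun t => ?_)
  dsimp only
  congr 1
  ring

lemma integral_exp_neg_sq_div_two_le : ∫ t : ℝ, Real.exp (-t ^ 2 / 2) ≤ 3 := by
  have h := integral_gaussian (1 / 2)
  have e : ∫ t : ℝ, Real.exp (-t ^ 2 / 2) = ∫ t : ℝ, Real.exp (-(1 / 2) * t ^ 2) := by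
    congr 1 with t
    congr 1
    ring
  rw [e, h, Real.sqrt_le_left (by norm_num)]
  have := Real.pi_le_four
  linarith

lemma integral_Ioi_exp_le {x : ℝ} (hx : 0 ≤ x) :
    ∫ t in Set.Ioi x, Real.exp (-t ^ 2 / 2) ≤ 3 * Real.exp (-x ^ 2 / 2) := by
  have hi := (integrable_exp_neg_sq_div_two.comp_sub_right x).const_mul (Real.exp (-x ^ 2 / 2))
  calc ∫ t in Set.Ioi x, Real.exp (-t ^ 2 / 2)
      ≤ ∫ t in Set.Ioi x, Real.exp (-x ^ 2 / 2) * Real.exp (-(t - x) ^ 2 / 2) := by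
        refine setIntegral_mono_on integrable_exp_neg_sq_div_two.integrableOn hi.integrableOn
          measurableSet_Ioi fun t ht => ?_
        rw [← Real.exp_add]
        apply Real.exp_le_exp.2
        have : 0 ≤ x * (t - x) := mul_nonneg hx (sub_nonneg.2 (Set.mem_Ioi.1 ht).le)
        nlinarith
    _ ≤ ∫ t, Real.exp (-x ^ 2 / 2) * Real.exp (-(t - x) ^ 2 / 2) :=
        setIntegral_le_integral hi (.of_forall fun t => by positivity)
    _ ≤ 3 * Real.exp (-x ^ 2 / 2) := by
        rw [integral_const_mul,
          integral_sub_right_eq_self (fun t => Real.exp (-t ^ 2 / 2)) x, mul_comm]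
        exact mul_le_mul_of_nonneg_right integral_exp_neg_sq_div_two_le (Real.exp_nonneg _)

/-- The Mills ratio bound, from `∫_{t > x} t e^{-t²/2} dt = e^{-x²/2}`. -/
lemma mul_integral_Ioi_exp_le {x : ℝ} (hx : 0 ≤ x) :
    x * ∫ t in Set.Ioi x, Real.exp (-t ^ 2 / 2) ≤ Real.exp (-x ^ 2 / 2) := by
  have hd : ∀ t ∈ Set.Ioi x, HasDerivAt (fun t : ℝ => -Real.exp (-t ^ 2 / 2))
      (t * Real.exp (-t ^ 2 / 2)) t := fun t _ => by
    refine HasDerivAt.congr_deriv (f := fun t : ℝ => -Real.exp (-t ^ 2 / 2))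
      (((hasDerivAt_pow 2 t).neg.div_const 2).exp).neg ?_
    simp only [Pi.neg_apply]
    ring
  have hc : ContinuousWithinAt (fun t : ℝ => -Real.exp (-t ^ 2 / 2)) (Set.Ici x) x := by
    fun_prop
  have hpos : ∀ t ∈ Set.Ioi x, 0 ≤ t * Real.exp (-t ^ 2 / 2) := fun t ht =>
    mul_nonneg (hx.trans (Set.mem_Ioi.1 ht).le) (Real.exp_nonneg _)
  have hl : Filter.Tendsto (fun t : ℝ => -Real.exp (-t ^ 2 / 2)) Filter.atTop (nhds 0) := by
    rw [← neg_zero]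
    refine (Real.tendsto_exp_atBot.comp ?_).neg
    have : Filter.Tendsto (fun t : ℝ => t ^ 2 / 2) Filter.atTop Filter.atTop :=
      (Filter.tendsto_pow_atTop two_ne_zero).atTop_div_const (by norm_num)
    simpa [neg_div, Function.comp_def] using Filter.tendsto_neg_atTop_atBot.comp this
  have h1 := integral_Ioi_of_hasDerivAt_of_nonneg hc hd hpos hl
  have h2 := integrableOn_Ioi_deriv_of_nonneg hc hd hpos hl
  rw [← integral_const_mul]
  calc _ ≤ ∫ t in Set.Ioi x, t * Real.exp (-t ^ 2 / 2) :=
        setIntegral_mono_on (integrable_exp_neg_sq_div_two.const_mul x).integrableOn h2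
          measurableSet_Ioi fun t ht =>
            mul_le_mul_of_nonneg_right (Set.mem_Ioi.1 ht).le (Real.exp_nonneg _)
    _ = _ := by rw [h1]; ring

/-- The density `(h t - Nh) e^{-t²/2}`, with `Nh` the standard Gaussian mean of `h`, whose
primitive solves the Stein equation for `h` after multiplication by `e^{x²/2}`. -/
noncomputable def steinDensity (h : ℝ → ℝ) (t : ℝ) : ℝ :=
  (h t - ∫ s, h s ∂gaussianReal 0 1) * Real.exp (-t ^ 2 / 2)

/-- The bounded solution `u` of the Stein equation `u' x - x u x = h x - Nh`. -/
noncomputable def steinSolution (h : ℝ → ℝ) (x : ℝ) : ℝ :=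
  Real.exp (x ^ 2 / 2) * ∫ t in Set.Iic x, steinDensity h t

section Stein

variable {h : ℝ → ℝ}

lemma integrable_gaussianReal_of_mem_Icc (hc : Continuous h) (h01 : ∀ x, h x ∈ Set.Icc (0 : ℝ) 1) :
    Integrable h (gaussianReal 0 1) :=
  Integrable.of_bound hc.aestronglyMeasurable 1 (.of_forall fun x => by
    rw [Real.norm_eq_abs, abs_of_nonneg (h01 x).1]; exact (h01 x).2)

lemma abs_sub_gaussianMean_le (hc : Continuous h) (h01 : ∀ x, h x ∈ Set.Icc (0 : ℝ) 1) (x : ℝ) :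
    |h x - ∫ s, h s ∂gaussianReal 0 1| ≤ 1 := by
  have h0 : 0 ≤ ∫ s, h s ∂gaussianReal 0 1 := integral_nonneg fun s => (h01 s).1
  have h1 : ∫ s, h s ∂gaussianReal 0 1 ≤ 1 := by
    have := integral_mono (integrable_gaussianReal_of_mem_Icc hc h01)
      (integrable_const (1 : ℝ)) fun s => (h01 s).2
    simpa using this
  have := h01 x
  rw [abs_le]
  constructor <;> linarith [this.1, this.2]

lemma continuous_steinDensity (hc : Continuous h) : Continuous (steinDensity h) := by
  unfold steinDensity
  fun_prop

lemma abs_steinDensity_le (hc : Continuous h) (h01 : ∀ x, h x ∈ Set.Icc (0 : ℝ) 1) (t : ℝ) :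
    |steinDensity h t| ≤ Real.exp (-t ^ 2 / 2) := by
  rw [steinDensity, abs_mul, abs_of_pos (Real.exp_pos _)]
  exact mul_le_of_le_one_left (Real.exp_nonneg _) (abs_sub_gaussianMean_le hc h01 t)

lemma integrable_steinDensity (hc : Continuous h) (h01 : ∀ x, h x ∈ Set.Icc (0 : ℝ) 1) :
    Integrable (steinDensity h) :=
  integrable_exp_neg_sq_div_two.mono' (continuous_steinDensity hc).aestronglyMeasurable
    (.of_forall (abs_steinDensity_le hc h01))

lemma integral_steinDensity (hc : Continuous h) (h01 : ∀ x, h x ∈ Set.Icc (0 : ℝ) 1) :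
    ∫ t, steinDensity h t = 0 := by
  have key : ∫ t, (h t - ∫ s, h s ∂gaussianReal 0 1) ∂gaussianReal 0 1 = 0 := by
    rw [integral_sub (integrable_gaussianReal_of_mem_Icc hc h01) (integrable_const _)]
    simp
  rw [integral_gaussianReal_eq_integral_smul one_ne_zero] at key
  have e : ∀ t : ℝ, gaussianPDFReal 0 1 t • (h t - ∫ s, h s ∂gaussianReal 0 1) =
      (√(2 * Real.pi))⁻¹ * steinDensity h t := fun t => by
    simp only [gaussianPDFReal, steinDensity, smul_eq_mul, NNReal.coe_one, mul_one, sub_zero]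
    ring
  simp_rw [e, integral_const_mul] at key
  exact (mul_eq_zero.1 key).resolve_left (by positivity)

lemma abs_integral_Iic_steinDensity_le (hc : Continuous h) (h01 : ∀ x, h x ∈ Set.Icc (0 : ℝ) 1)
    (x : ℝ) : |∫ t in Set.Iic x, steinDensity h t| ≤
      ∫ t in Set.Ioi |x|, Real.exp (-t ^ 2 / 2) := by
  have hi := integrable_steinDensity hc h01
  rcases le_total 0 x with hx | hx
  · -- the total mass vanishes, so the upper tail may replace the lower one
    have hs : ∫ t in Set.Iic x, steinDensity h t = -∫ t in Set.Ioi x, steinDensity h t := by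
      have := intervalIntegral.integral_Iic_add_Ioi (b := x) hi.integrableOn hi.integrableOn
      rw [integral_steinDensity hc h01] at this
      linarith
    rw [hs, abs_neg, abs_of_nonneg hx]
    exact norm_integral_le_of_norm_le (f := steinDensity h)
      integrable_exp_neg_sq_div_two.integrableOn (.of_forall fun t => abs_steinDensity_le hc h01 t)
  · rw [abs_of_nonpos hx]
    have := integral_comp_neg_Iic x fun t : ℝ => Real.exp (-t ^ 2 / 2)
    simp only [neg_sq] at this
    rw [← this]
    exact norm_integral_le_of_norm_le (f := steinDensity h)
      integrable_exp_neg_sq_div_two.integrableOn (.of_forall fun t => abs_steinDensity_le hc h01 t)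

lemma abs_steinSolution_le (hc : Continuous h) (h01 : ∀ x, h x ∈ Set.Icc (0 : ℝ) 1) (x : ℝ) :
    |steinSolution h x| ≤ 3 := by
  rw [steinSolution, abs_mul, abs_of_pos (Real.exp_pos _)]
  have h1 := (abs_integral_Iic_steinDensity_le hc h01 x).trans (integral_Ioi_exp_le (abs_nonneg x))
  rw [sq_abs] at h1
  calc _ ≤ Real.exp (x ^ 2 / 2) * (3 * Real.exp (-x ^ 2 / 2)) :=
        mul_le_mul_of_nonneg_left h1 (Real.exp_nonneg _)
    _ = 3 * Real.exp (x ^ 2 / 2 + -x ^ 2 / 2) := by rw [Real.exp_add]; ring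
    _ = 3 := by rw [neg_div, add_neg_cancel, Real.exp_zero, mul_one]

lemma abs_mul_steinSolution_le (hc : Continuous h) (h01 : ∀ x, h x ∈ Set.Icc (0 : ℝ) 1) (x : ℝ) :
    |x * steinSolution h x| ≤ 1 := by
  rw [steinSolution, abs_mul, abs_mul, abs_of_pos (Real.exp_pos _)]
  have h1 := (mul_le_mul_of_nonneg_left (abs_integral_Iic_steinDensity_le hc h01 x)
    (abs_nonneg x)).trans (mul_integral_Ioi_exp_le (abs_nonneg x))
  rw [sq_abs] at h1
  calc _ = Real.exp (x ^ 2 / 2) * (|x| * |∫ t in Set.Iic x, steinDensity h t|) := by ring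
    _ ≤ Real.exp (x ^ 2 / 2) * Real.exp (-x ^ 2 / 2) :=
        mul_le_mul_of_nonneg_left h1 (Real.exp_nonneg _)
    _ = Real.exp (x ^ 2 / 2 + -x ^ 2 / 2) := by rw [Real.exp_add]
    _ = 1 := by rw [neg_div, add_neg_cancel, Real.exp_zero]

/-- The derivative of `steinSolution h`, as the Stein equation prescribes it. -/
noncomputable def steinDeriv (h : ℝ → ℝ) (x : ℝ) : ℝ :=
  x * steinSolution h x + (h x - ∫ s, h s ∂gaussianReal 0 1)

lemma hasDerivAt_steinSolution (hc : Continuous h) (h01 : ∀ x, h x ∈ Set.Icc (0 : ℝ) 1) (x : ℝ) :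
    HasDerivAt (steinSolution h) (steinDeriv h x) x := by
  have hi := integrable_steinDensity hc h01
  have hF : (fun y => ∫ t in Set.Iic y, steinDensity h t) = fun y =>
      (∫ t in (0 : ℝ)..y, steinDensity h t) + ∫ t in Set.Iic (0 : ℝ), steinDensity h t := by
    ext y
    rw [← intervalIntegral.integral_Iic_sub_Iic hi.integrableOn hi.integrableOn]
    ring
  have hd : HasDerivAt (fun y => ∫ t in Set.Iic y, steinDensity h t) (steinDensity h x) x := by
    rw [hF]
    exact (intervalIntegral.integral_hasDerivAt_right hi.intervalIntegrable
      (continuous_steinDensity hc).stronglyMeasurable.stronglyMeasurableAtFilter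
      (continuous_steinDensity hc).continuousAt).add_const _
  have he : HasDerivAt (fun y : ℝ => Real.exp (y ^ 2 / 2)) (Real.exp (x ^ 2 / 2) * x) x := by
    convert ((hasDerivAt_pow 2 x).div_const 2).exp using 1
    ring
  refine HasDerivAt.congr_deriv (f := steinSolution h) (he.mul hd) ?_
  rw [steinDeriv, steinSolution, steinDensity,
    show Real.exp (x ^ 2 / 2) * ((h x - ∫ s, h s ∂gaussianReal 0 1) * Real.exp (-x ^ 2 / 2)) =
      (h x - ∫ s, h s ∂gaussianReal 0 1) * Real.exp (x ^ 2 / 2 + -x ^ 2 / 2) by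
        rw [Real.exp_add]; ring, neg_div, add_neg_cancel, Real.exp_zero]
  ring

lemma continuous_steinSolution (hc : Continuous h) (h01 : ∀ x, h x ∈ Set.Icc (0 : ℝ) 1) :
    Continuous (steinSolution h) :=
  continuous_iff_continuousAt.2 fun x => (hasDerivAt_steinSolution hc h01 x).continuousAt

lemma abs_steinDeriv_le (hc : Continuous h) (h01 : ∀ x, h x ∈ Set.Icc (0 : ℝ) 1) (x : ℝ) :
    |steinDeriv h x| ≤ 2 := by
  have h1 := abs_mul_steinSolution_le hc h01 x
  have h2 := abs_sub_gaussianMean_le hc h01 x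
  exact (abs_add_le _ _).trans (by linarith)

lemma abs_steinSolution_sub_le (hc : Continuous h) (h01 : ∀ x, h x ∈ Set.Icc (0 : ℝ) 1) (x y : ℝ) :
    |steinSolution h x - steinSolution h y| ≤ 2 * |x - y| :=
  convex_univ.norm_image_sub_le_of_norm_hasDerivWithin_le
    (fun z _ => (hasDerivAt_steinSolution hc h01 z).hasDerivWithinAt)
    (fun z _ => abs_steinDeriv_le hc h01 z) (Set.mem_univ y) (Set.mem_univ x)

/-- The derivative of the Stein solution is not uniformly Lipschitz for a bounded test function,
but its modulus of continuity at `w` grows only linearly in `|w|`. -/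
lemma abs_steinDeriv_sub_le (hc : Continuous h) (h01 : ∀ x, h x ∈ Set.Icc (0 : ℝ) 1) {L : ℝ}
    (hL : ∀ x y, |h x - h y| ≤ L * |x - y|) (x w : ℝ) :
    |steinDeriv h x - steinDeriv h w| ≤ |x - w| * (3 + 2 * |w| + L) := by
  have e : steinDeriv h x - steinDeriv h w = (x - w) * steinSolution h x +
      w * (steinSolution h x - steinSolution h w) + (h x - h w) := by
    unfold steinDeriv; ring
  rw [e]
  calc _ ≤ |(x - w) * steinSolution h x| + |w * (steinSolution h x - steinSolution h w)| +
        |h x - h w| := abs_add_three _ _ _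
    _ ≤ |x - w| * 3 + |w| * (2 * |x - w|) + L * |x - w| := by
        rw [abs_mul, abs_mul]
        gcongr
        · exact abs_steinSolution_le hc h01 x
        · exact abs_steinSolution_sub_le hc h01 x w
        · exact hL x w
    _ = _ := by ring

lemma abs_steinSolution_taylor_le (hc : Continuous h) (h01 : ∀ x, h x ∈ Set.Icc (0 : ℝ) 1) {L : ℝ}
    (hL0 : 0 ≤ L) (hL : ∀ x y, |h x - h y| ≤ L * |x - y|) (w e : ℝ) :
    |steinSolution h w - steinSolution h (w - e) - e * steinDeriv h w| ≤
      e ^ 2 * (3 + 2 * |w| + L) := by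
  have hd : ∀ x ∈ Set.uIcc (w - e) w,
      HasDerivWithinAt (fun x => steinSolution h x - x * steinDeriv h w)
        (steinDeriv h x - 1 * steinDeriv h w) (Set.uIcc (w - e) w) x := fun x _ =>
    ((hasDerivAt_steinSolution hc h01 x).sub
      ((hasDerivAt_id x).mul_const _)).hasDerivWithinAt
  have hb : ∀ x ∈ Set.uIcc (w - e) w,
      ‖steinDeriv h x - 1 * steinDeriv h w‖ ≤ |e| * (3 + 2 * |w| + L) := fun x hx => by
    rw [one_mul]
    refine (abs_steinDeriv_sub_le hc h01 hL x w).trans ?_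
    have := Set.abs_sub_right_of_mem_uIcc hx
    rw [sub_sub_cancel, abs_sub_comm] at this
    gcongr
  have := (convex_uIcc (w - e) w).norm_image_sub_le_of_norm_hasDerivWithin_le hd hb
    Set.left_mem_uIcc Set.right_mem_uIcc
  rw [Real.norm_eq_abs, Real.norm_eq_abs, sub_sub_cancel] at this
  calc _ = |steinSolution h w - w * steinDeriv h w -
        (steinSolution h (w - e) - (w - e) * steinDeriv h w)| := by congr 1; ring
    _ ≤ _ := this
    _ = |e| ^ 2 * (3 + 2 * |w| + L) := by ring
    _ = _ := by rw [sq_abs]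

end Stein

/-! ### Weights on families of finite sets -/

section LocalWeights

variable {I ι : Type*} [DecidableEq I]

/-- Nonnegative weights `b p`, `p ∈ s`, attached to finite sets `U p` of at most `k` points, such
that the sets through any one point carry total weight at most `M`. -/
structure LocalWeights (s : Finset ι) (U : ι → Finset I) (b : ι → ℝ) (k : ℕ) (M : ℝ) : Prop where
  nonneg : ∀ p ∈ s, 0 ≤ b p
  nonempty : ∀ p ∈ s, (U p).Nonempty
  card_le : ∀ p ∈ s, (U p).card ≤ k
  sum_le : ∀ i, ∑ p ∈ s with i ∈ U p, b p ≤ M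

/-- The pairs of indices from `s` whose sets meet. -/
def meetingPairs (s : Finset ι) (U : ι → Finset I) : Finset (ι × ι) :=
  (s ×ˢ s).filter fun x => ¬Disjoint (U x.2) (U x.1)

namespace LocalWeights

variable {s : Finset ι} {U : ι → Finset I} {b : ι → ℝ} {k : ℕ} {M : ℝ}

lemma bound_nonneg [Nonempty I] (hw : LocalWeights s U b k M) : 0 ≤ M :=
  (Finset.sum_nonneg fun p hp => hw.nonneg p (Finset.mem_filter.1 hp).1).trans
    (hw.sum_le (Classical.arbitrary I))

lemma sum_meeting_le (hw : LocalWeights s U b k M) (T : Finset I) :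
    ∑ q ∈ s with ¬Disjoint (U q) T, b q ≤ T.card * M := by
  calc ∑ q ∈ s with ¬Disjoint (U q) T, b q
      ≤ ∑ q ∈ s, ∑ i ∈ T, if i ∈ U q then b q else 0 := by
        rw [Finset.sum_filter]
        refine Finset.sum_le_sum fun q hq => ?_
        have h0 : ∀ i ∈ T, 0 ≤ if i ∈ U q then b q else 0 := fun i _ => by
          split_ifs
          exacts [hw.nonneg q hq, le_rfl]
        by_cases h : Disjoint (U q) T
        · rw [if_neg (not_not.2 h)]
          exact Finset.sum_nonneg h0
        · rw [if_pos h]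
          obtain ⟨i, hi, hiT⟩ := Finset.not_disjoint_iff.1 h
          exact (if_pos hi).ge.trans (Finset.single_le_sum h0 hiT)
    _ = ∑ i ∈ T, ∑ q ∈ s with i ∈ U q, b q := by
        rw [Finset.sum_comm]
        simp_rw [Finset.sum_filter]
    _ ≤ ∑ _i ∈ T, M := Finset.sum_le_sum fun i _ => hw.sum_le i
    _ = _ := by rw [Finset.sum_const, nsmul_eq_mul]

lemma sum_meeting_le_mul [Nonempty I] (hw : LocalWeights s U b k M) {T : Finset I}
    (hT : T.card ≤ k) : ∑ q ∈ s with ¬Disjoint (U q) T, b q ≤ k * M := by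
  have hM := hw.bound_nonneg
  exact (hw.sum_meeting_le T).trans (by gcongr)

variable [Fintype I]

lemma sum_le_card_mul (hw : LocalWeights s U b k M) : ∑ q ∈ s, b q ≤ Fintype.card I * M := by
  have := hw.sum_meeting_le Finset.univ
  rwa [Finset.card_univ, Finset.filter_true_of_mem fun q hq => ?_] at this
  obtain ⟨i, hi⟩ := hw.nonempty q hq
  exact Finset.not_disjoint_iff.2 ⟨i, hi, Finset.mem_univ i⟩

lemma sum_mul_sum_meeting_le [Nonempty I] (hw : LocalWeights s U b k M) :
    ∑ p ∈ s, b p * ∑ q ∈ s with ¬Disjoint (U q) (U p), b q ≤ Fintype.card I * k * M ^ 2 := by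
  have hM := hw.bound_nonneg
  calc _ ≤ ∑ p ∈ s, b p * (k * M) := Finset.sum_le_sum fun p hp =>
        mul_le_mul_of_nonneg_left (hw.sum_meeting_le_mul (hw.card_le p hp)) (hw.nonneg p hp)
    _ = (∑ p ∈ s, b p) * (k * M) := by rw [Finset.sum_mul]
    _ ≤ (Fintype.card I * M) * (k * M) :=
        mul_le_mul_of_nonneg_right hw.sum_le_card_mul (by positivity)
    _ = _ := by ring

end LocalWeights

lemma sum_meetingPairs {s : Finset ι} {U : ι → Finset I} (g : ι → ι → ℝ) :
    ∑ x ∈ meetingPairs s U, g x.1 x.2 = ∑ p ∈ s, ∑ q ∈ s with ¬Disjoint (U q) (U p), g p q := by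
  rw [meetingPairs, Finset.sum_filter, Finset.sum_product]
  simp_rw [Finset.sum_filter]

/-- Products over meeting pairs inherit the local weight structure of the factors. -/
lemma LocalWeights.pairs [Nonempty I] {s : Finset ι} {U : ι → Finset I} {b : ι → ℝ} {k : ℕ} {M : ℝ}
    (hw : LocalWeights s U b k M) :
    LocalWeights (meetingPairs s U) (fun x => U x.1 ∪ U x.2) (fun x => b x.1 * b x.2)
      (2 * k) (2 * k * M ^ 2) := by
  have hmem : ∀ x ∈ meetingPairs s U, x.1 ∈ s ∧ x.2 ∈ s := fun x hx =>
    Finset.mem_product.1 (Finset.mem_filter.1 hx).1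
  have hM := hw.bound_nonneg
  have hb : ∀ x ∈ meetingPairs s U, 0 ≤ b x.1 * b x.2 := fun x hx =>
    mul_nonneg (hw.nonneg _ (hmem x hx).1) (hw.nonneg _ (hmem x hx).2)
  refine ⟨hb, ?_, ?_, fun i => ?_⟩
  · exact fun x hx => (hw.nonempty x.1 (hmem x hx).1).mono Finset.subset_union_left
  · intro x hx
    have h1 := hw.card_le _ (hmem x hx).1
    have h2 := hw.card_le _ (hmem x hx).2
    have := Finset.card_union_le (U x.1) (U x.2)
    omega
  have half : ∑ p ∈ s, ∑ q ∈ s with ¬Disjoint (U q) (U p),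
      (if i ∈ U p then b p * b q else 0) ≤ k * M ^ 2 := by
    calc _ = ∑ p ∈ s with i ∈ U p, b p * ∑ q ∈ s with ¬Disjoint (U q) (U p), b q := by
          rw [Finset.sum_filter]
          refine Finset.sum_congr rfl fun p _ => ?_
          split_ifs
          · rw [Finset.mul_sum]
          · simp
      _ ≤ ∑ p ∈ s with i ∈ U p, b p * (k * M) := Finset.sum_le_sum fun p hp => by
          have hp' := (Finset.mem_filter.1 hp).1
          exact mul_le_mul_of_nonneg_left (hw.sum_meeting_le_mul (hw.card_le p hp'))
            (hw.nonneg p hp')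
      _ = (∑ p ∈ s with i ∈ U p, b p) * (k * M) := by rw [Finset.sum_mul]
      _ ≤ M * (k * M) := mul_le_mul_of_nonneg_right (hw.sum_le i) (by positivity)
      _ = _ := by ring
  have half' : ∑ p ∈ s, ∑ q ∈ s with ¬Disjoint (U q) (U p),
      (if i ∈ U q then b p * b q else 0) ≤ k * M ^ 2 := by
    refine le_trans (le_of_eq ?_) half
    simp_rw [Finset.sum_filter]
    rw [Finset.sum_comm]
    refine Finset.sum_congr rfl fun q _ => Finset.sum_congr rfl fun p _ => ?_
    simp only [disjoint_comm, mul_comm (b p)]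
  calc ∑ x ∈ meetingPairs s U with i ∈ U x.1 ∪ U x.2, b x.1 * b x.2
      ≤ ∑ x ∈ meetingPairs s U, ((if i ∈ U x.1 then b x.1 * b x.2 else 0) +
          if i ∈ U x.2 then b x.1 * b x.2 else 0) := by
        rw [Finset.sum_filter]
        refine Finset.sum_le_sum fun x hx => ?_
        have := hb x hx
        simp only [Finset.mem_union]
        split_ifs with h1 h2 h3 <;> first | linarith | tauto
    _ ≤ k * M ^ 2 + k * M ^ 2 := by
        rw [Finset.sum_add_distrib,
          sum_meetingPairs (fun p q => if i ∈ U p then b p * b q else 0),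
          sum_meetingPairs (fun p q => if i ∈ U q then b p * b q else 0)]
        exact add_le_add half half'
    _ = _ := by ring

end LocalWeights

/-! ### Locally dependent random variables -/

section LocalFamily

variable {Ω I ι : Type*}

/-- The σ-algebra generated by the `m i` with `i ∈ S`. -/
@[reducible]
def sigmaOn (m : I → MeasurableSpace Ω) (S : Finset I) : MeasurableSpace Ω :=
  ⨆ i ∈ (S : Set I), m i

lemma sigmaOn_mono (m : I → MeasurableSpace Ω) {S T : Finset I} (h : S ⊆ T) :
    sigmaOn m S ≤ sigmaOn m T :=
  biSup_mono fun _ hi => h hi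

variable [mΩ : MeasurableSpace Ω] {P : Measure Ω}

lemma sigmaOn_le {m : I → MeasurableSpace Ω} (hm : ∀ i, m i ≤ mΩ) (S : Finset I) :
    sigmaOn m S ≤ mΩ :=
  iSup₂_le fun i _ => hm i

lemma indepFun_of_disjoint {m : I → MeasurableSpace Ω} (hm : ∀ i, m i ≤ mΩ) (hind : iIndep m P)
    {S T : Finset I} (hST : Disjoint S T) {Y Z : Ω → ℝ} (hY : Measurable[sigmaOn m S] Y)
    (hZ : Measurable[sigmaOn m T] Z) : IndepFun Y Z P := by
  rw [IndepFun_iff_Indep]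
  exact indep_of_indep_of_le_left (indep_of_indep_of_le_right
    (indep_iSup_of_disjoint hm hind (Finset.disjoint_coe.2 hST)) hZ.comap_le) hY.comap_le

/-- A family of random variables `ξ p`, bounded by `b p`, each of which depends only on the
independent σ-algebras `m i` with `i ∈ U p`. -/
structure LocalFamily (P : Measure Ω) (m : I → MeasurableSpace Ω) (s : Finset ι)
    (U : ι → Finset I) (b : ι → ℝ) (ξ : ι → Ω → ℝ) : Prop where
  le : ∀ i, m i ≤ mΩ
  indep : iIndep m P
  meas : ∀ p ∈ s, Measurable[sigmaOn m (U p)] (ξ p)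
  bound : ∀ p ∈ s, ∀ᵐ ω ∂P, |ξ p ω| ≤ b p

namespace LocalFamily

variable {m : I → MeasurableSpace Ω} {s : Finset ι} {U : ι → Finset I} {b : ι → ℝ}
  {ξ : ι → Ω → ℝ}

lemma measurable (hξ : LocalFamily P m s U b ξ) {p : ι} (hp : p ∈ s) : Measurable (ξ p) :=
  (hξ.meas p hp).mono (sigmaOn_le hξ.le _) le_rfl

lemma measurable_sum (hξ : LocalFamily P m s U b ξ) {t : Finset ι} (ht : t ⊆ s) :
    Measurable fun ω => ∑ p ∈ t, ξ p ω :=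
  Finset.measurable_fun_sum _ fun _ hp => hξ.measurable (ht hp)

lemma ae_bound (hξ : LocalFamily P m s U b ξ) : ∀ᵐ ω ∂P, ∀ p ∈ s, |ξ p ω| ≤ b p :=
  (Filter.eventually_all_finset s).2 hξ.bound

lemma ae_abs_sum_le (hξ : LocalFamily P m s U b ξ) {t : Finset ι} (ht : t ⊆ s) :
    ∀ᵐ ω ∂P, |∑ p ∈ t, ξ p ω| ≤ ∑ p ∈ t, b p := by
  filter_upwards [hξ.ae_bound] with ω hω
  exact (Finset.abs_sum_le_sum_abs _ _).trans (Finset.sum_le_sum fun p hp => hω p (ht hp))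

lemma memLp [IsProbabilityMeasure P] (hξ : LocalFamily P m s U b ξ) {p : ι} (hp : p ∈ s) :
    MemLp (ξ p) 2 P :=
  MemLp.of_bound (hξ.measurable hp).aestronglyMeasurable (b p) (hξ.bound p hp)

lemma integrable [IsProbabilityMeasure P] (hξ : LocalFamily P m s U b ξ) {p : ι} (hp : p ∈ s) :
    Integrable (ξ p) P :=
  (hξ.memLp hp).integrable (by norm_num)

variable [DecidableEq I]

lemma pairs (hξ : LocalFamily P m s U b ξ) :
    LocalFamily P m (meetingPairs s U) (fun x => U x.1 ∪ U x.2) (fun x => b x.1 * b x.2)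
      (fun x ω => ξ x.1 ω * ξ x.2 ω) := by
  have hmem : ∀ x ∈ meetingPairs s U, x.1 ∈ s ∧ x.2 ∈ s := fun x hx =>
    Finset.mem_product.1 (Finset.mem_filter.1 hx).1
  refine ⟨hξ.le, hξ.indep, fun x hx => ?_, fun x hx => ?_⟩
  · exact ((hξ.meas _ (hmem x hx).1).mono (sigmaOn_mono m Finset.subset_union_left) le_rfl).mul
      ((hξ.meas _ (hmem x hx).2).mono (sigmaOn_mono m Finset.subset_union_right) le_rfl)
  · filter_upwards [hξ.bound _ (hmem x hx).1, hξ.bound _ (hmem x hx).2] with ω h1 h2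
    rw [abs_mul]
    exact mul_le_mul h1 h2 (abs_nonneg _) ((abs_nonneg _).trans h1)

variable [IsProbabilityMeasure P]

lemma covariance_le (hξ : LocalFamily P m s U b ξ) {p q : ι} (hp : p ∈ s) (hq : q ∈ s) :
    cov[ξ p, ξ q; P] ≤ if ¬Disjoint (U q) (U p) then 2 * (b p * b q) else 0 := by
  by_cases h : Disjoint (U q) (U p)
  · rw [if_neg (not_not.2 h)]
    exact ((indepFun_of_disjoint hξ.le hξ.indep h.symm (hξ.meas p hp)
      (hξ.meas q hq)).covariance_eq_zero (hξ.memLp hp) (hξ.memLp hq)).le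
  · rw [if_pos h]
    have habs : ∀ r ∈ s, |∫ ω, ξ r ω ∂P| ≤ b r := fun r hr => by
      simpa using norm_integral_le_of_norm_le_const (f := ξ r) (hξ.bound r hr)
    have hprod : |∫ ω, (ξ p * ξ q) ω ∂P| ≤ b p * b q := by
      have : ∀ᵐ ω ∂P, ‖(ξ p * ξ q) ω‖ ≤ b p * b q := by
        filter_upwards [hξ.bound p hp, hξ.bound q hq] with ω h1 h2
        rw [Pi.mul_apply, norm_mul]
        exact mul_le_mul h1 h2 (abs_nonneg _) ((abs_nonneg _).trans h1)
      simpa using norm_integral_le_of_norm_le_const this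
    have hmul : |(∫ ω, ξ p ω ∂P) * ∫ ω, ξ q ω ∂P| ≤ b p * b q := by
      rw [abs_mul]
      exact mul_le_mul (habs p hp) (habs q hq) (abs_nonneg _) ((abs_nonneg _).trans (habs p hp))
    rw [covariance_eq_sub (hξ.memLp hp) (hξ.memLp hq)]
    linarith [(abs_le.1 hprod).2, (abs_le.1 hmul).1]

variable [Fintype I] [Nonempty I] {k : ℕ} {M : ℝ}

lemma variance_sum_le (hξ : LocalFamily P m s U b ξ) (hw : LocalWeights s U b k M) :
    Var[fun ω => ∑ p ∈ s, ξ p ω; P] ≤ 2 * (Fintype.card I * k * M ^ 2) := by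
  rw [variance_fun_sum' fun p hp => hξ.memLp hp]
  calc _ ≤ ∑ p ∈ s, ∑ q ∈ s, if ¬Disjoint (U q) (U p) then 2 * (b p * b q) else 0 :=
        Finset.sum_le_sum fun p hp => Finset.sum_le_sum fun q hq => hξ.covariance_le hp hq
    _ = 2 * ∑ p ∈ s, b p * ∑ q ∈ s with ¬Disjoint (U q) (U p), b q := by
        simp_rw [← Finset.sum_filter, Finset.mul_sum]
    _ ≤ _ := by gcongr; exact hw.sum_mul_sum_meeting_le

end LocalFamily

end LocalFamily

/-! ### Stein's method under local dependence -/

namespace LocalFamily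

variable {Ω I ι : Type*} [mΩ : MeasurableSpace Ω] {P : Measure Ω}
  {m : I → MeasurableSpace Ω} {s : Finset ι} {U : ι → Finset I} {b : ι → ℝ} {ξ : ι → Ω → ℝ}

lemma integrable_mul [IsProbabilityMeasure P] (hξ : LocalFamily P m s U b ξ) {p q : ι}
    (hp : p ∈ s) (hq : q ∈ s) : Integrable (fun ω => ξ p ω * ξ q ω) P :=
  (hξ.memLp hp).integrable_mul (hξ.memLp hq)

variable [DecidableEq I]

/-- A centred variable is orthogonal to any function of the part of the sum that does not share
an independent coordinate with it. -/
lemma integral_mul_comp_sum_disjoint (hξ : LocalFamily P m s U b ξ) {p : ι} (hp : p ∈ s)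
    (hmean : ∫ ω, ξ p ω ∂P = 0) {u : ℝ → ℝ} (hu : Measurable u) :
    ∫ ω, ξ p ω * u (∑ q ∈ s with Disjoint (U q) (U p), ξ q ω) ∂P = 0 := by
  set t := s.filter fun q => Disjoint (U q) (U p) with ht
  have hm : Measurable[sigmaOn m (t.biUnion U)] fun ω => u (∑ q ∈ t, ξ q ω) :=
    hu.comp (Finset.measurable_fun_sum _ fun q hq =>
      (hξ.meas q (Finset.mem_filter.1 hq).1).mono
        (sigmaOn_mono m (Finset.subset_biUnion_of_mem U hq)) le_rfl)
  have hd : Disjoint (U p) (t.biUnion U) :=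
    (Finset.disjoint_biUnion_right _ _ _).2 fun q hq => (Finset.mem_filter.1 hq).2.symm
  rw [(indepFun_of_disjoint hξ.le hξ.indep hd (hξ.meas p hp) hm).integral_fun_mul_eq_mul_integral
    (hξ.measurable hp).aestronglyMeasurable
    (hm.mono (sigmaOn_le hξ.le _) le_rfl).aestronglyMeasurable, hmean, zero_mul]

variable [IsProbabilityMeasure P]

/-- For centred variables only the products over meeting pairs contribute to the second moment
of the sum. -/
lemma integral_sum_sq (hξ : LocalFamily P m s U b ξ) (hmean : ∀ p ∈ s, ∫ ω, ξ p ω ∂P = 0) :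
    ∫ ω, (∑ p ∈ s, ξ p ω) ^ 2 ∂P =
      ∫ ω, ∑ x ∈ meetingPairs s U, ξ x.1 ω * ξ x.2 ω ∂P := by
  have e : ∀ ω, ∑ x ∈ meetingPairs s U, ξ x.1 ω * ξ x.2 ω =
      ∑ p ∈ s, ∑ q ∈ s with ¬Disjoint (U q) (U p), ξ p ω * ξ q ω := fun ω =>
    sum_meetingPairs fun p q => ξ p ω * ξ q ω
  simp_rw [e, sq, Finset.sum_mul_sum]
  rw [integral_finsetSum _ fun p hp => integrable_finsetSum _ fun q hq =>
      hξ.integrable_mul hp hq,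
    integral_finsetSum _ fun p hp => integrable_finsetSum _ fun q hq =>
      hξ.integrable_mul hp (Finset.mem_filter.1 hq).1]
  refine Finset.sum_congr rfl fun p hp => ?_
  rw [integral_finsetSum _ fun q hq => hξ.integrable_mul hp hq,
    integral_finsetSum _ fun q hq => hξ.integrable_mul hp (Finset.mem_filter.1 hq).1,
    Finset.sum_filter]
  refine Finset.sum_congr rfl fun q hq => ?_
  by_cases h : Disjoint (U q) (U p)
  · rw [if_neg (not_not.2 h), (indepFun_of_disjoint hξ.le hξ.indep h.symm (hξ.meas p hp)
      (hξ.meas q hq)).integral_fun_mul_eq_mul_integral (hξ.measurable hp).aestronglyMeasurable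
      (hξ.measurable hq).aestronglyMeasurable, hmean p hp, zero_mul]
  · rw [if_pos h]

variable [Fintype I] [Nonempty I] {k : ℕ} {M : ℝ}

lemma integral_sum_sq_le (hξ : LocalFamily P m s U b ξ) (hw : LocalWeights s U b k M)
    (hmean : ∀ p ∈ s, ∫ ω, ξ p ω ∂P = 0) :
    ∫ ω, (∑ p ∈ s, ξ p ω) ^ 2 ∂P ≤ Fintype.card I * k * M ^ 2 := by
  rw [hξ.integral_sum_sq hmean]
  have h1 := norm_integral_le_of_norm_le_const
    (f := fun ω => ∑ x ∈ meetingPairs s U, ξ x.1 ω * ξ x.2 ω)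
    (hξ.pairs.ae_abs_sum_le (Finset.Subset.refl _))
  rw [probReal_univ, mul_one, sum_meetingPairs fun p q => b p * b q] at h1
  simp_rw [← Finset.mul_sum] at h1
  exact (le_abs_self _).trans (h1.trans hw.sum_mul_sum_meeting_le)

/-- The quadratic form `∑ ξ p ξ q` over meeting pairs concentrates around its mean `1`, because it
is itself a sum of locally dependent variables. -/
lemma integral_abs_one_sub_pairs_le (hξ : LocalFamily P m s U b ξ) (hw : LocalWeights s U b k M)
    (hmean : ∀ p ∈ s, ∫ ω, ξ p ω ∂P = 0) (hvar : ∫ ω, (∑ p ∈ s, ξ p ω) ^ 2 ∂P = 1) :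
    ∫ ω, |1 - ∑ x ∈ meetingPairs s U, ξ x.1 ω * ξ x.2 ω| ∂P ≤
      √(16 * Fintype.card I * k ^ 3) * M ^ 2 := by
  set V : Ω → ℝ := fun ω => ∑ x ∈ meetingPairs s U, ξ x.1 ω * ξ x.2 ω with hV
  have hVm : MemLp V 2 P := MemLp.of_bound
    (hξ.pairs.measurable_sum (Finset.Subset.refl _)).aestronglyMeasurable _
    (hξ.pairs.ae_abs_sum_le (Finset.Subset.refl _))
  have hVi : MemLp (fun ω => |1 - V ω|) 2 P := ((memLp_const (1 : ℝ)).sub hVm).abs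
  have hmeanV : ∫ ω, V ω ∂P = 1 := by rw [← hvar, hξ.integral_sum_sq hmean]
  have hsq : ∫ ω, |1 - V ω| ^ 2 ∂P = Var[V; P] := by
    rw [variance_eq_integral hVm.aemeasurable, hmeanV]
    congr 1 with ω
    rw [sq_abs]
    ring
  have hJ : (∫ ω, |1 - V ω| ∂P) ^ 2 ≤ Var[V; P] := by
    have h0 := variance_nonneg (fun ω => |1 - V ω|) P
    rw [variance_eq_sub hVi] at h0
    have : ∫ ω, ((fun ω => |1 - V ω|) ^ 2) ω ∂P = Var[V; P] := hsq
    linarith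
  have hv := hξ.pairs.variance_sum_le hw.pairs
  push_cast at hv
  calc ∫ ω, |1 - V ω| ∂P ≤ √(16 * Fintype.card I * k ^ 3 * (M ^ 2) ^ 2) := by
        refine Real.le_sqrt_of_sq_le (hJ.trans (hv.trans (le_of_eq ?_)))
        ring
    _ = _ := by rw [Real.sqrt_mul (by positivity), Real.sqrt_sq (by positivity)]

/-- The normal approximation for Lipschitz test functions: with `W = ∑ ξ p` and `W p` the part of `W`
independent of `ξ p`, expand `E W u(W) = ∑ E ξ p (u(W) - u(W p))` to first order, where `u` solves
the Stein equation for `h`. -/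
theorem abs_integral_sub_gaussian_le (hξ : LocalFamily P m s U b ξ) (hw : LocalWeights s U b k M)
    (hmean : ∀ p ∈ s, ∫ ω, ξ p ω ∂P = 0) (hvar : ∫ ω, (∑ p ∈ s, ξ p ω) ^ 2 ∂P = 1)
    {h : ℝ → ℝ} (hc : Continuous h) (h01 : ∀ x, h x ∈ Set.Icc (0 : ℝ) 1) {L : ℝ}
    (hL0 : 0 ≤ L) (hL : ∀ x y, |h x - h y| ≤ L * |x - y|) :
    |∫ ω, h (∑ p ∈ s, ξ p ω) ∂P - ∫ x, h x ∂gaussianReal 0 1| ≤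
      Fintype.card I * M * (k * M) ^ 2 * (5 + L) + 2 * (√(16 * Fintype.card I * k ^ 3) * M ^ 2) := by
  set W : Ω → ℝ := fun ω => ∑ p ∈ s, ξ p ω with hW
  set V : Ω → ℝ := fun ω => ∑ x ∈ meetingPairs s U, ξ x.1 ω * ξ x.2 ω with hV
  set Wd : ι → Ω → ℝ := fun p ω => ∑ q ∈ s with Disjoint (U q) (U p), ξ q ω with hWd
  set η : ι → Ω → ℝ := fun p ω => ∑ q ∈ s with ¬Disjoint (U q) (U p), ξ q ω with hη
  have hWm : Measurable W := hξ.measurable_sum (Finset.Subset.refl _)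
  have hVmeas : Measurable V := hξ.pairs.measurable_sum (Finset.Subset.refl _)
  have hVi : Integrable V P := Integrable.of_bound hVmeas.aestronglyMeasurable _
    (hξ.pairs.ae_abs_sum_le (Finset.Subset.refl _))
  have hW2 : MemLp W 2 P := MemLp.of_bound hWm.aestronglyMeasurable _
    (hξ.ae_abs_sum_le (Finset.Subset.refl _))
  have hWdη : ∀ p ω, Wd p ω = W ω - η p ω := fun p ω => by
    have := Finset.sum_filter_add_sum_filter_not s (fun q => Disjoint (U q) (U p)) fun q => ξ q ω
    simp only [hW, hWd, hη]
    linarith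
  have hVη : ∀ ω, V ω = ∑ p ∈ s, ξ p ω * η p ω := fun ω => by
    simp only [hV, hη, Finset.mul_sum]
    exact sum_meetingPairs fun p q => ξ p ω * ξ q ω
  have hηb : ∀ᵐ ω ∂P, ∀ p ∈ s, |η p ω| ≤ k * M :=
    (Filter.eventually_all_finset s).2 fun p hp => by
      filter_upwards [hξ.ae_abs_sum_le (Finset.filter_subset
        (fun q => ¬Disjoint (U q) (U p)) s)] with ω hω
      exact hω.trans (hw.sum_meeting_le_mul (hw.card_le p hp))
  have huc := continuous_steinSolution hc h01
  have hint : ∀ p ∈ s, Integrable (fun ω => ξ p ω * steinSolution h (Wd p ω)) P := fun p hp => by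
    refine (hξ.integrable hp).mul_bdd (c := 3) (huc.measurable.comp
      (hξ.measurable_sum (Finset.filter_subset _ s))).aestronglyMeasurable
      (.of_forall fun ω => abs_steinSolution_le hc h01 _)
  have hzero : ∫ ω, ∑ p ∈ s, ξ p ω * steinSolution h (Wd p ω) ∂P = 0 := by
    rw [integral_finsetSum _ hint]
    exact Finset.sum_eq_zero fun p hp =>
      hξ.integral_mul_comp_sum_disjoint hp (hmean p hp) huc.measurable
  have hhi : Integrable (fun ω => h (W ω)) P :=
    Integrable.of_bound (hc.measurable.comp hWm).aestronglyMeasurable 1 (.of_forall fun ω => by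
      rw [Real.norm_eq_abs, abs_of_nonneg (h01 _).1]; exact (h01 _).2)
  have hmain : ∫ ω, h (W ω) ∂P - ∫ x, h x ∂gaussianReal 0 1 =
      ∫ ω, (h (W ω) - ∫ x, h x ∂gaussianReal 0 1 +
        ∑ p ∈ s, ξ p ω * steinSolution h (Wd p ω)) ∂P := by
    have hhN : Integrable (fun ω => h (W ω) - ∫ x, h x ∂gaussianReal 0 1) P :=
      hhi.sub (integrable_const _)
    rw [integral_add hhN (integrable_finsetSum _ hint), hzero,
      integral_sub hhi (integrable_const _)]
    simp
  have hWabs : Integrable (fun ω => |W ω|) P := (hW2.integrable (by norm_num)).abs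
  have hWi : ∫ ω, |W ω| ∂P ≤ 1 := by
    have hsq : Integrable (fun ω => W ω ^ 2) P := hW2.integrable_sq
    have := integral_mono hWabs (((integrable_const (1 : ℝ)).add hsq).div_const 2) fun ω => by
      show |W ω| ≤ (1 + W ω ^ 2) / 2
      rw [← sq_abs]
      nlinarith [sq_nonneg (|W ω| - 1)]
    rw [integral_div] at this
    simp only [Pi.add_apply] at this
    rw [integral_add (integrable_const _) hsq, hvar] at this
    simpa using this
  have hVabs : Integrable (fun ω => |1 - V ω|) P := ((integrable_const 1).sub hVi).abs
  set C := (∑ p ∈ s, b p) * (k * M) ^ 2 with hC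
  have hC0 : 0 ≤ C := mul_nonneg (Finset.sum_nonneg hw.nonneg) (sq_nonneg _)
  have hbound : ∀ᵐ ω ∂P, ‖h (W ω) - ∫ x, h x ∂gaussianReal 0 1 +
      ∑ p ∈ s, ξ p ω * steinSolution h (Wd p ω)‖ ≤
      C * (3 + L) + (2 * C) * |W ω| + 2 * |1 - V ω| := by
    filter_upwards [hξ.ae_bound, hηb] with ω h1 h2
    have e : h (W ω) - ∫ x, h x ∂gaussianReal 0 1 +
        ∑ p ∈ s, ξ p ω * steinSolution h (Wd p ω) = steinDeriv h (W ω) * (1 - V ω) -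
        ∑ p ∈ s, ξ p ω * (steinSolution h (W ω) - steinSolution h (W ω - η p ω) -
          η p ω * steinDeriv h (W ω)) := by
      have hWs : ∑ p ∈ s, ξ p ω * steinSolution h (W ω) = W ω * steinSolution h (W ω) := by
        rw [← Finset.sum_mul]
      have hVs : ∑ p ∈ s, ξ p ω * (η p ω * steinDeriv h (W ω)) = V ω * steinDeriv h (W ω) := by
        rw [hVη, Finset.sum_mul]
        exact Finset.sum_congr rfl fun p _ => by ring
      simp only [mul_sub (ξ _ ω), Finset.sum_sub_distrib, hWs, hVs, hWdη]
      rw [steinDeriv]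
      ring
    rw [e, Real.norm_eq_abs]
    have hrem : |∑ p ∈ s, ξ p ω * (steinSolution h (W ω) - steinSolution h (W ω - η p ω) -
        η p ω * steinDeriv h (W ω))| ≤ C * (3 + 2 * |W ω| + L) := by
      refine (Finset.abs_sum_le_sum_abs _ _).trans ?_
      rw [hC, mul_assoc, Finset.sum_mul]
      refine Finset.sum_le_sum fun p hp => ?_
      rw [abs_mul]
      refine mul_le_mul (h1 p hp) ((abs_steinSolution_taylor_le hc h01 hL0 hL _ _).trans ?_)
        (abs_nonneg _) (hw.nonneg p hp)
      refine mul_le_mul_of_nonneg_right ?_ (by positivity)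
      rw [← sq_abs]
      exact pow_le_pow_left₀ (abs_nonneg _) (h2 p hp) 2
    have hlin : |steinDeriv h (W ω) * (1 - V ω)| ≤ 2 * |1 - V ω| := by
      rw [abs_mul]
      exact mul_le_mul_of_nonneg_right (abs_steinDeriv_le hc h01 _) (abs_nonneg _)
    refine (abs_sub _ _).trans ?_
    linarith
  rw [hmain]
  have hfin := norm_integral_le_of_norm_le
    (((integrable_const (C * (3 + L))).add (hWabs.const_mul (2 * C))).add (hVabs.const_mul 2))
    hbound
  refine hfin.trans ?_
  have hsplit : ∫ ω, (C * (3 + L) + (2 * C) * |W ω| + 2 * |1 - V ω|) ∂P =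
      C * (3 + L) + (2 * C) * ∫ ω, |W ω| ∂P + 2 * ∫ ω, |1 - V ω| ∂P := by
    have hCW : Integrable (fun ω => C * (3 + L) + (2 * C) * |W ω|) P :=
      (integrable_const _).add (hWabs.const_mul (2 * C))
    rw [integral_add hCW (hVabs.const_mul 2),
      integral_add (integrable_const _) (hWabs.const_mul (2 * C)), integral_const_mul (2 * C),
      integral_const_mul 2]
    simp
  refine hsplit.le.trans ?_
  have hV1 := hξ.integral_abs_one_sub_pairs_le hw hmean hvar
  have hCle : C ≤ Fintype.card I * M * (k * M) ^ 2 :=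
    mul_le_mul_of_nonneg_right hw.sum_le_card_mul (sq_nonneg _)
  have h5 : C * (5 + L) ≤ Fintype.card I * M * (k * M) ^ 2 * (5 + L) :=
    mul_le_mul_of_nonneg_right hCle (by linarith)
  have h6 : 2 * C * ∫ ω, |W ω| ∂P ≤ 2 * C * 1 := mul_le_mul_of_nonneg_left hWi (by linarith)
  linarith

end LocalFamily

/-! ### From Lipschitz test functions to the Kolmogorov distance -/

/-- The test function that is `1` up to `z`, `0` from `z + ε` on, and affine in between. -/
noncomputable def ramp (z ε x : ℝ) : ℝ := max (min (1 + (z - x) / ε) 1) 0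

section Ramp

variable {z ε : ℝ}

lemma continuous_ramp : Continuous (ramp z ε) := by
  unfold ramp
  fun_prop

lemma ramp_mem_Icc (x : ℝ) : ramp z ε x ∈ Set.Icc (0 : ℝ) 1 :=
  ⟨le_max_right _ _, max_le (min_le_right _ _) zero_le_one⟩

lemma ramp_eq_one (hε : 0 < ε) {x : ℝ} (hx : x ≤ z) : ramp z ε x = 1 := by
  have : 0 ≤ (z - x) / ε := div_nonneg (sub_nonneg.2 hx) hε.le
  rw [ramp, min_eq_right (by linarith), max_eq_left zero_le_one]

lemma ramp_eq_zero (hε : 0 < ε) {x : ℝ} (hx : z + ε ≤ x) : ramp z ε x = 0 := by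
  have : (z - x) / ε ≤ -1 := by
    rw [div_le_iff₀ hε]
    linarith
  rw [ramp, max_eq_right]
  exact (min_le_left _ _).trans (by linarith)

lemma abs_ramp_sub_le (hε : 0 < ε) (x y : ℝ) : |ramp z ε x - ramp z ε y| ≤ 1 / ε * |x - y| := by
  calc _ ≤ |min (1 + (z - x) / ε) 1 - min (1 + (z - y) / ε) 1| := abs_max_sub_max_le_abs _ _ _
    _ ≤ |1 + (z - x) / ε - (1 + (z - y) / ε)| := by
        simpa using abs_min_sub_min_le_max (1 + (z - x) / ε) 1 (1 + (z - y) / ε) 1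
    _ = |(1 / ε) * (y - x)| := by congr 1; ring
    _ = _ := by rw [abs_mul, abs_of_pos (one_div_pos.2 hε), abs_sub_comm]

lemma measureReal_setOf_le_le_integral_ramp {Ω : Type*} [MeasurableSpace Ω] {P : Measure Ω}
    [IsProbabilityMeasure P] {W : Ω → ℝ} (hW : Measurable W) (hε : 0 < ε) :
    P.real {ω | W ω ≤ z} ≤ ∫ ω, ramp z ε (W ω) ∂P := by
  have hs : MeasurableSet {ω | W ω ≤ z} := measurableSet_le hW measurable_const
  rw [← integral_indicator_one hs]
  refine integral_mono ((integrable_const 1).indicator hs)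
    (Integrable.of_bound (continuous_ramp.measurable.comp hW).aestronglyMeasurable 1
      (.of_forall fun ω => ?_)) fun ω => ?_
  · rw [Real.norm_eq_abs, abs_of_nonneg (ramp_mem_Icc _).1]
    exact (ramp_mem_Icc _).2
  · refine Set.indicator_le' (fun ω hω => ?_) (fun ω _ => (ramp_mem_Icc _).1) ω
    exact (ramp_eq_one hε hω).ge

lemma integral_ramp_le_measureReal_setOf_lt {Ω : Type*} [MeasurableSpace Ω] {P : Measure Ω}
    [IsProbabilityMeasure P] {W : Ω → ℝ} (hW : Measurable W) (hε : 0 < ε) :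
    ∫ ω, ramp z ε (W ω) ∂P ≤ P.real {ω | W ω < z + ε} := by
  have hs : MeasurableSet {ω | W ω < z + ε} := measurableSet_lt hW measurable_const
  rw [← integral_indicator_one hs]
  refine integral_mono (Integrable.of_bound
    (continuous_ramp.measurable.comp hW).aestronglyMeasurable 1
      (.of_forall fun ω => ?_)) ((integrable_const 1).indicator hs) fun ω => ?_
  · rw [Real.norm_eq_abs, abs_of_nonneg (ramp_mem_Icc _).1]
    exact (ramp_mem_Icc _).2
  · refine Set.le_indicator (fun ω _ => (ramp_mem_Icc _).2) (fun ω hω => ?_) ω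
    exact (ramp_eq_zero hε (not_lt.1 hω)).le

end Ramp

lemma gaussianPDFReal_le_one (x : ℝ) : gaussianPDFReal 0 1 x ≤ 1 := by
  have h1 : (√(2 * Real.pi * ((1 : NNReal) : ℝ)))⁻¹ ≤ 1 := by
    refine inv_le_one_of_one_le₀ (Real.one_le_sqrt.2 ?_)
    rw [NNReal.coe_one]
    linarith [Real.two_le_pi]
  refine mul_le_one₀ h1 (Real.exp_nonneg _) (Real.exp_le_one_iff.2 ?_)
  exact div_nonpos_of_nonpos_of_nonneg (neg_nonpos.2 (sq_nonneg _)) (by positivity)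

lemma stdNormalCDF_add_le (x : ℝ) {ε : ℝ} (hε : 0 ≤ ε) :
    stdNormalCDF (x + ε) ≤ stdNormalCDF x + ε := by
  have hu : Set.Iic (x + ε) = Set.Iic x ∪ Set.Ioc x (x + ε) :=
    (Set.Iic_union_Ioc_eq_Iic (by linarith)).symm
  have h1 : (gaussianReal 0 1).real (Set.Ioc x (x + ε)) ≤ ε := by
    rw [measureReal_def, gaussianReal_apply_eq_integral 0 one_ne_zero, ENNReal.toReal_ofReal
      (integral_nonneg fun t => gaussianPDFReal_nonneg _ _ _)]
    have := setIntegral_mono_on (μ := volume) (s := Set.Ioc x (x + ε))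
      (integrable_gaussianPDFReal 0 1).integrableOn
      (integrableOn_const (C := (1 : ℝ)) (by simp)) measurableSet_Ioc
      fun t _ => gaussianPDFReal_le_one t
    simpa [hε] using this
  rw [stdNormalCDF, stdNormalCDF, cdf_eq_real, cdf_eq_real, hu]
  exact (measureReal_union_le _ _).trans (by linarith)

lemma abs_measureReal_lt_sub_stdNormalCDF_le {Ω : Type*} [MeasurableSpace Ω] {P : Measure Ω}
    [IsProbabilityMeasure P] {W : Ω → ℝ} (hW : Measurable W) {ε B : ℝ} (hε : 0 < ε)
    (hB : ∀ z, |∫ ω, ramp z ε (W ω) ∂P - ∫ x, ramp z ε x ∂gaussianReal 0 1| ≤ B) (lam : ℝ) :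
    |P.real {ω | W ω < lam} - stdNormalCDF lam| ≤ ε + B := by
  have hΦ : ∀ y, (gaussianReal 0 1).real {x | x ≤ y} = stdNormalCDF y := fun y => by
    rw [stdNormalCDF, cdf_eq_real, Set.Iic_def]
  rw [abs_le]
  constructor
  · have h1 := measureReal_setOf_le_le_integral_ramp (P := gaussianReal 0 1) (z := lam - ε)
      measurable_id hε
    have h2 := integral_ramp_le_measureReal_setOf_lt (P := P) (z := lam - ε) hW hε
    have h3 := (abs_le.1 (hB (lam - ε))).1
    have h4 := stdNormalCDF_add_le (lam - ε) hε.le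
    simp only [id, hΦ] at h1
    rw [sub_add_cancel] at h2 h4
    linarith
  · have h1 : P.real {ω | W ω < lam} ≤ P.real {ω | W ω ≤ lam} :=
      measureReal_mono fun ω (hω : W ω < lam) => hω.le
    have h2 := measureReal_setOf_le_le_integral_ramp (P := P) (z := lam) hW hε
    have h3 := integral_ramp_le_measureReal_setOf_lt (P := gaussianReal 0 1) (z := lam)
      measurable_id hε
    have h4 := (abs_le.1 (hB lam)).2
    have h5 := stdNormalCDF_add_le lam hε.le
    have h6 : (gaussianReal 0 1).real {x | x < lam + ε} ≤ stdNormalCDF (lam + ε) := by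
      rw [← hΦ]
      exact measureReal_mono fun x (hx : x < lam + ε) => hx.le
    simp only [id] at h3
    linarith

/-! ### Exponentially decaying weights -/

lemma sum_pow_le_of_injOn {κ : Type*} {r : ℝ} (h0 : 0 ≤ r) (h1 : r < 1) (T : Finset κ) (g : κ → ℕ)
    (hg : Set.InjOn g T) : ∑ j ∈ T, r ^ g j ≤ (1 - r)⁻¹ := by
  classical
  rw [← Finset.sum_image (f := fun n => r ^ n) hg, ← tsum_geometric_of_lt_one h0 h1]
  exact (summable_geometric_of_lt_one h0 h1).sum_le_tsum _ fun n _ => pow_nonneg h0 n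

/-- One of the two truncated differences vanishes, so the exponent is the distance of `i`
and `j`. -/
lemma sum_pow_dist_le {m : ℕ} {r : ℝ} (h0 : 0 ≤ r) (h1 : r < 1) (i : Fin m) :
    ∑ j : Fin m, r ^ (((j : ℕ) - i) + (i - j)) ≤ 2 * (1 - r)⁻¹ := by
  rw [← Finset.sum_filter_add_sum_filter_not _ fun j : Fin m => j ≤ i, two_mul]
  refine add_le_add (sum_pow_le_of_injOn h0 h1 _ _ ?_) (sum_pow_le_of_injOn h0 h1 _ _ ?_) <;>
  · intro x hx y hy hxy
    simp only [Finset.coe_filter, Finset.mem_univ, true_and, Set.mem_ofPred_eq, Fin.le_def] at hx hy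
    simp only at hxy
    ext
    omega

lemma dist_le_indexDiam {m : ℕ} {A : Finset (Fin m)} {i j : Fin m} (hi : i ∈ A) (hj : j ∈ A) :
    ((j : ℕ) - i) + (i - j) ≤ indexDiam A := by
  have h : A.Nonempty := ⟨i, hi⟩
  have h1 := Fin.le_def.1 (A.le_max' i hi)
  have h2 := Fin.le_def.1 (A.le_max' j hj)
  have h3 := Fin.le_def.1 (A.min'_le i hi)
  have h4 := Fin.le_def.1 (A.min'_le j hj)
  rw [indexDiam, dif_pos h]
  omega

/-- A bound, uniform in the number of indices, for the total weight `∑ e^{-c diam A}` of the sets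
`A` through a fixed index with `|A| ≤ a`. -/
noncomputable def expWeightBound (a : ℕ) (c : ℝ) : ℝ :=
  Real.exp (2 * (1 - Real.exp (-(c / a)))⁻¹)

/-- Every `j ∈ A` has distance at most `diam A` from `i ∈ A`, so `e^{-c diam A}` is at most the
product of `e^{-(c/a)|j - i|}` over `j ∈ A`; the sum of these products over all sets `A` is the
product of the `1 + e^{-(c/a)|j - i|}` over all indices `j`. -/
lemma sum_exp_indexDiam_le {a : ℕ} (ha : 0 < a) {c : ℝ} (hc : 0 < c) {m : ℕ} (i : Fin m) :
    ∑ A ∈ subsetsUpTo m a with i ∈ A, Real.exp (-c * indexDiam A) ≤ expWeightBound a c := by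
  set r := Real.exp (-(c / a)) with hr
  have ha' : (0 : ℝ) < a := Nat.cast_pos.2 ha
  have hr0 : 0 ≤ r := Real.exp_nonneg _
  have hr1 : r < 1 := Real.exp_lt_one_iff.2 (neg_lt_zero.2 (div_pos hc ha'))
  calc _ ≤ ∑ A ∈ subsetsUpTo m a with i ∈ A, ∏ j ∈ A, r ^ (((j : ℕ) - i) + (i - j)) := by
        refine Finset.sum_le_sum fun A hA => ?_
        obtain ⟨hA, hi⟩ := Finset.mem_filter.1 hA
        have hcard : A.card ≤ a := (Finset.mem_filter.1 hA).2
        have he : Real.exp (-c * indexDiam A) = r ^ (a * indexDiam A) := by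
          rw [hr, ← Real.exp_nat_mul]
          congr 1
          push_cast
          field_simp
        rw [he, Finset.prod_pow_eq_pow_sum]
        refine pow_le_pow_of_le_one hr0 hr1.le ?_
        calc _ ≤ ∑ _j ∈ A, indexDiam A := Finset.sum_le_sum fun j hj => dist_le_indexDiam hi hj
          _ = A.card * indexDiam A := by rw [Finset.sum_const, smul_eq_mul]
          _ ≤ _ := Nat.mul_le_mul_right _ hcard
    _ ≤ ∑ A ∈ (Finset.univ : Finset (Fin m)).powerset,
          ∏ j ∈ A, r ^ (((j : ℕ) - i) + (i - j)) :=
        Finset.sum_le_sum_of_subset_of_nonneg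
          (fun A _ => Finset.mem_powerset.2 (Finset.subset_univ A))
          fun A _ _ => Finset.prod_nonneg fun j _ => pow_nonneg hr0 _
    _ = ∏ j : Fin m, (1 + r ^ (((j : ℕ) - i) + (i - j))) := (Finset.prod_one_add _).symm
    _ ≤ ∏ j : Fin m, Real.exp (r ^ (((j : ℕ) - i) + (i - j))) :=
        Finset.prod_le_prod (fun j _ => by positivity) fun j _ => by
          rw [add_comm]
          exact Real.add_one_le_exp _
    _ = Real.exp (∑ j : Fin m, r ^ (((j : ℕ) - i) + (i - j))) := (Real.exp_sum _ _).symm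
    _ ≤ _ := Real.exp_le_exp.2 (sum_pow_dist_le hr0 hr1 i)

lemma localWeights_exp {a : ℕ} (ha : 0 < a) {c : ℝ} (hc : 0 < c) (m : ℕ) {σ : ℝ} (hσ : 0 < σ) :
    LocalWeights ((subsetsUpTo m a).filter Finset.Nonempty) id
      (fun A => Real.exp (-c * indexDiam A) / σ) a (expWeightBound a c / σ) := by
  refine ⟨fun A _ => by positivity, fun A hA => (Finset.mem_filter.1 hA).2,
    fun A hA => (Finset.mem_filter.1 (Finset.mem_filter.1 hA).1).2, fun i => ?_⟩
  rw [← Finset.sum_div]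
  refine div_le_div_of_nonneg_right (le_trans ?_ (sum_exp_indexDiam_le ha hc i)) hσ.le
  exact Finset.sum_le_sum_of_subset_of_nonneg
    (Finset.filter_subset_filter _ (Finset.filter_subset _ _)) fun A _ _ => Real.exp_nonneg _

/-! ### Functions of few independent variables -/

lemma localFamily_subfamily {Ω : Type*} [MeasurableSpace Ω] {P : Measure Ω}
    {m : ℕ} {X : Fin m → Ω → ℝ} (hX : ∀ i, Measurable (X i)) (hind : iIndepFun X P)
    {s : Finset (Finset (Fin m))} {f : (A : Finset (Fin m)) → (A → ℝ) → ℝ}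
    (hf : ∀ A ∈ s, Measurable (f A)) {c σ : ℝ} (hσ : 0 < σ)
    (hb : ∀ A ∈ s, ∀ᵐ ω ∂P, |f A (subfamily X A ω)| ≤ Real.exp (-c * (indexDiam A : ℝ))) :
    LocalFamily P (fun i => MeasurableSpace.comap (X i) inferInstance) s id
      (fun A => Real.exp (-c * indexDiam A) / σ) (fun A ω => f A (subfamily X A ω) / σ) := by
  refine ⟨fun i => (hX i).comap_le, hind, fun A hA => ?_, fun A hA => ?_⟩
  · refine ((hf A hA).div_const σ).comp
      (@measurable_pi_lambda _ _ _ (sigmaOn _ _) _ (subfamily X A) fun i => ?_)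
    exact (comap_measurable (X i)).mono (le_iSup₂ (f := fun j (_ : j ∈ (A : Set (Fin m))) =>
      MeasurableSpace.comap (X j) inferInstance) (i : Fin m) i.2) le_rfl
  · filter_upwards [hb A hA] with ω hω
    rw [abs_div, abs_of_pos hσ]
    exact div_le_div_of_nonneg_right hω hσ.le

/-- The empty set contributes a constant, which vanishes when it has mean zero. -/
lemma localSum_eq_sum_nonempty {Ω : Type*} [MeasurableSpace Ω] {P : Measure Ω}
    [IsProbabilityMeasure P] {m a : ℕ} {X : Fin m → Ω → ℝ}
    {f : (A : Finset (Fin m)) → (A → ℝ) → ℝ}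
    (h0 : ∫ ω, f ∅ (subfamily X ∅ ω) ∂P = 0) (ω : Ω) :
    localSum a X f ω = ∑ A ∈ subsetsUpTo m a with A.Nonempty, f A (subfamily X A ω) := by
  have hconst : ∀ ω', f ∅ (subfamily X ∅ ω') = f ∅ (subfamily X ∅ ω) := fun ω' =>
    congrArg (f ∅) (Subsingleton.elim _ _)
  simp_rw [hconst] at h0
  rw [integral_const, probReal_univ, one_smul] at h0
  rw [localSum, Finset.sum_filter]
  refine Finset.sum_congr rfl fun A _ => ?_
  by_cases hA : A.Nonempty
  · rw [if_pos hA]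
  · rw [if_neg hA]
    obtain rfl := Finset.not_nonempty_iff_eq_empty.1 hA
    exact h0

/-- With `m = x ^ 4` and ramps of width `x ^ 3 / σ ^ 2`, all error terms have the order of
the width. -/
lemma ramp_width_add_error_le {x σ S k : ℝ} (hx : 1 ≤ x) (hσ : 0 < σ) (hS : 0 < S) (hk : 1 ≤ k)
    (hδ : x ^ 3 < σ ^ 2) (hσ2 : σ ^ 2 ≤ x ^ 4 * k * S ^ 2) :
    x ^ 3 / σ ^ 2 + (x ^ 4 * (S / σ) * (k * (S / σ)) ^ 2 * (5 + 1 / (x ^ 3 / σ ^ 2)) +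
      2 * (√(16 * x ^ 4 * k ^ 3) * (S / σ) ^ 2)) ≤
      (1 + 6 * k ^ 3 * S ^ 4 + 8 * k ^ 2 * S ^ 2) * (x ^ 3 / σ ^ 2) := by
  have hx0 : 0 < x := by linarith
  have hk0 : 0 < k := by linarith
  have hσle : σ ≤ x ^ 2 * k * S := by
    refine (sq_le_sq₀ hσ.le (by positivity)).1 (hσ2.trans ?_)
    have : k ≤ k ^ 2 := by nlinarith
    calc x ^ 4 * k * S ^ 2 ≤ x ^ 4 * k ^ 2 * S ^ 2 := by gcongr
      _ = _ := by ring
  have hsqrt : √(16 * x ^ 4 * k ^ 3) ≤ 4 * x ^ 2 * k ^ 2 := by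
    refine Real.sqrt_le_iff.2 ⟨by positivity, ?_⟩
    have : k ^ 3 ≤ k ^ 4 := pow_le_pow_right₀ hk (by norm_num)
    calc 16 * x ^ 4 * k ^ 3 ≤ 16 * x ^ 4 * k ^ 4 := by gcongr
      _ = _ := by ring
  have h5 : 5 + 1 / (x ^ 3 / σ ^ 2) ≤ 6 * (σ ^ 2 / x ^ 3) := by
    rw [one_div_div]
    have : 1 ≤ σ ^ 2 / x ^ 3 := (one_le_div (by positivity)).2 hδ.le
    linarith
  have t1 : x ^ 4 * (S / σ) * (k * (S / σ)) ^ 2 * (5 + 1 / (x ^ 3 / σ ^ 2)) ≤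
      6 * k ^ 3 * S ^ 4 * (x ^ 3 / σ ^ 2) := by
    calc _ ≤ x ^ 4 * (S / σ) * (k * (S / σ)) ^ 2 * (6 * (σ ^ 2 / x ^ 3)) := by gcongr
      _ = 6 * k ^ 2 * S ^ 3 * x / σ ^ 2 * σ := by field_simp
      _ ≤ 6 * k ^ 2 * S ^ 3 * x / σ ^ 2 * (x ^ 2 * k * S) := by gcongr
      _ = _ := by ring
  have t2 : 2 * (√(16 * x ^ 4 * k ^ 3) * (S / σ) ^ 2) ≤ 8 * k ^ 2 * S ^ 2 * (x ^ 3 / σ ^ 2) := by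
    calc _ ≤ 2 * ((4 * x ^ 2 * k ^ 2) * (S / σ) ^ 2) := by gcongr
      _ = 8 * k ^ 2 * S ^ 2 * (x ^ 2 / σ ^ 2) := by ring
      _ ≤ _ := by
        gcongr
        norm_num
  linarith

/-! ### The normal approximation -/

theorem theorem9 (a : ℕ) (ha : 2 ≤ a) (c : ℝ) (hc : 0 < c) :
    ∃ K : ℝ, 0 < K ∧
      ∀ (m : ℕ), a ≤ m →
      ∀ (Ω : Type*) [MeasurableSpace Ω] (P : Measure Ω) [IsProbabilityMeasure P]
        (X : Fin m → Ω → ℝ) (f : (A : Finset (Fin m)) → (A → ℝ) → ℝ) (σ : ℝ),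
        (∀ i, Measurable (X i)) →
        iIndepFun X P →
        (∀ A ∈ subsetsUpTo m a, Measurable (f A)) →
        (∀ A ∈ subsetsUpTo m a, ∫ ω, f A (subfamily X A ω) ∂P = 0) →
        (∀ A ∈ subsetsUpTo m a,
          ∀ᵐ ω ∂P, |f A (subfamily X A ω)| ≤ Real.exp (-c * (indexDiam A : ℝ))) →
        0 < σ →
        σ ^ 2 = ∫ ω, localSum a X f ω ^ 2 ∂P →
        ∀ lam : ℝ,
          |P.real {ω | 1 / σ * localSum a X f ω < lam} - stdNormalCDF lam| ≤
            K * (Real.log m ^ (1 / 4 : ℝ) * ((m : ℝ) ^ (3 / 4 : ℝ) / σ ^ 2)) := by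
  set S := expWeightBound a c with hSdef
  have hS : 0 < S := Real.exp_pos _
  have hk : (1 : ℝ) ≤ a := by exact_mod_cast (by omega : 1 ≤ a)
  set K₀ : ℝ := 1 + 6 * (a : ℝ) ^ 3 * S ^ 4 + 8 * (a : ℝ) ^ 2 * S ^ 2 with hK₀
  have hK₀1 : 1 ≤ K₀ := by
    have h1 : 0 ≤ 6 * (a : ℝ) ^ 3 * S ^ 4 := by positivity
    have h2 : 0 ≤ 8 * (a : ℝ) ^ 2 * S ^ 2 := by positivity
    linarith
  have hlog2 : 0 < Real.log 2 ^ (1 / 4 : ℝ) := Real.rpow_pos_of_pos (Real.log_pos one_lt_two) _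
  refine ⟨K₀ / Real.log 2 ^ (1 / 4 : ℝ), by positivity, ?_⟩
  intro m ham Ω _ P _ X f σ hX hind hf hmean hb hσ hσ2 lam
  have hm2 : (2 : ℝ) ≤ m := by exact_mod_cast ha.trans ham
  set δ : ℝ := (m : ℝ) ^ (3 / 4 : ℝ) / σ ^ 2 with hδdef
  have hδ0 : 0 < δ := by positivity
  -- the logarithm is bounded below, so an estimate without it suffices
  suffices hmain : |P.real {ω | 1 / σ * localSum a X f ω < lam} - stdNormalCDF lam| ≤ K₀ * δ by
    refine hmain.trans ?_
    have hlog : Real.log 2 ^ (1 / 4 : ℝ) ≤ Real.log m ^ (1 / 4 : ℝ) :=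
      Real.rpow_le_rpow (Real.log_nonneg one_le_two) (Real.log_le_log two_pos hm2) (by norm_num)
    calc K₀ * δ = K₀ / Real.log 2 ^ (1 / 4 : ℝ) * (Real.log 2 ^ (1 / 4 : ℝ) * δ) := by
          field_simp
      _ ≤ _ := by gcongr
  rcases le_or_gt 1 δ with h1δ | h1δ
  · -- two probabilities differ by at most `1`
    have h1 : stdNormalCDF lam ∈ Set.Icc (0 : ℝ) 1 := ⟨cdf_nonneg _ _, cdf_le_one _ _⟩
    have h2 : |P.real {ω | 1 / σ * localSum a X f ω < lam} - stdNormalCDF lam| ≤ 1 := by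
      rw [abs_le]
      constructor <;> linarith [h1.1, h1.2, measureReal_nonneg (μ := P)
        (s := {ω | 1 / σ * localSum a X f ω < lam}), measureReal_le_one (μ := P)
        (s := {ω | 1 / σ * localSum a X f ω < lam})]
    exact h2.trans (one_le_mul_of_one_le_of_one_le hK₀1 h1δ)
  have : Nonempty (Fin m) := ⟨⟨0, by omega⟩⟩
  set s := (subsetsUpTo m a).filter Finset.Nonempty with hs
  have hss : s ⊆ subsetsUpTo m a := Finset.filter_subset _ _
  have hξ := localFamily_subfamily hX hind (fun A hA => hf A (hss hA)) hσ
    fun A hA => hb A (hss hA)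
  have hw := localWeights_exp (by omega : 0 < a) hc m hσ
  have hmean' : ∀ A ∈ s, ∫ ω, f A (subfamily X A ω) / σ ∂P = 0 := fun A hA => by
    rw [integral_div, hmean A (hss hA), zero_div]
  have hW : ∀ ω, 1 / σ * localSum a X f ω = ∑ A ∈ s, f A (subfamily X A ω) / σ := fun ω => by
    rw [localSum_eq_sum_nonempty (hmean ∅ (Finset.mem_filter.2 ⟨Finset.mem_univ _, by simp⟩)),
      ← Finset.sum_div]
    ring
  have hvar : ∫ ω, (∑ A ∈ s, f A (subfamily X A ω) / σ) ^ 2 ∂P = 1 := by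
    simp_rw [← hW, mul_pow]
    rw [integral_const_mul, ← hσ2]
    field_simp
  -- the variance is at most of order `m`
  have hσm := hξ.integral_sum_sq_le hw hmean'
  rw [hvar, Fintype.card_fin] at hσm
  set x : ℝ := (m : ℝ) ^ (1 / 4 : ℝ) with hx
  have hx1 : 1 ≤ x := Real.one_le_rpow (by linarith) (by norm_num)
  have hx4 : (m : ℝ) = x ^ 4 := by
    rw [hx, ← Real.rpow_natCast, ← Real.rpow_mul (by positivity)]
    norm_num
  have hδx : δ = x ^ 3 / σ ^ 2 := by
    rw [hδdef, hx, ← Real.rpow_natCast ((m : ℝ) ^ (1 / 4 : ℝ)), ← Real.rpow_mul (by positivity)]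
    norm_num
  have hσ2' : σ ^ 2 ≤ x ^ 4 * a * S ^ 2 := by
    rw [hx4, div_pow, mul_div_assoc', le_div_iff₀ (by positivity), one_mul] at hσm
    exact hσm
  have hδ1 : x ^ 3 < σ ^ 2 := by
    rwa [hδx, div_lt_one (by positivity)] at h1δ
  simp_rw [hW]
  refine (abs_measureReal_lt_sub_stdNormalCDF_le (hξ.measurable_sum (Finset.Subset.refl _)) hδ0
    (fun z => hξ.abs_integral_sub_gaussian_le hw hmean' hvar continuous_ramp ramp_mem_Icc
      (one_div_nonneg.2 hδ0.le) (abs_ramp_sub_le hδ0)) lam).trans ?_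
  rw [Fintype.card_fin, hx4, hδx]
  exact ramp_width_add_error_le hx1 hσ hS hk hδ1 hσ2'
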